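/- Let $K$ be a field with a nontrivial discrete valuation $v : K^\times \to \mathbb{Z}$ (with $v(0)=\infty$), and let $\mathscr{K}$ be a first-order expansion of the valued field $(K,v)$, that is, a first-order structure with underlying set $K$ in which the field operations and the relation $v(x) \le v(y)$ are definable ("definable" always means first-order definable, possibly with parameters). Suppose $\mathscr{K}$ is dp-minimal, i.e. its complete theory $T$ has dp-rank at most $1$: for every highly saturated $\mathscr{M} \models T$, every small set $A \subseteq M$ of parameters, any two infinite sequences $I_0, I_1$ of finite tuples of elements of $M$ that are mutually indiscernible over $A$ (each is indiscernible over the union of $A$ and the elements of the other), and every $b \in M$, at least one of $I_0, I_1$ is indiscernible over $A \cup \{b\}$. For $a \in K$ and $k \in \mathbb{Z}$ let $B(a,k) = \{ b \in K : v(a-b) \ge k\}$, and for $n \ge 1$ let $P_n = \{ c^n : c \in K^\times \}$. Then for every $\mathscr{K}$-definable set $X \subseteq K$ and every $a \in K$ there are $k \in \mathbb{Z}$ and a set $Y$, which is a (possibly empty) finite union of sets of the form $a + bP_n$ with $b \in K$ and $n \ge 1$, such that $B(a,k) \cap X = B(a,k) \cap Y$. -/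

import Mathlib

universe u v w w' x

open FirstOrder

namespace DpMin

/-- A sequence `(I 0, I 1, ...)` of `m`-tuples of elements of the structure `N` is indiscernible
over the parameter set `B`: any two increasing finite subsequences of the same length satisfy
the same first-order formulas with parameters from `B`. -/
def Indiscernible {L : FirstOrder.Language.{u, v}} {N : Type w} [L.Structure N] (B : Set N) {m : ℕ}
    (I : ℕ → Fin m → N) : Prop :=
  ∀ (n : ℕ) (φ : L[[B]].Formula (Fin n × Fin m)) (i j : Fin n → ℕ),
    StrictMono i → StrictMono j →
      (φ.Realize (fun p => I (i p.1) p.2) ↔ φ.Realize (fun p => I (j p.1) p.2))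

/-- A family `(I t : t ∈ ι)` of sequences is mutually indiscernible over `A`: each `I t` is
indiscernible over the union of `A` and of all elements occurring in the sequences `I s`,
`s ≠ t`. -/
def MutuallyIndiscernible (L : FirstOrder.Language.{u, v}) {N : Type w} [L.Structure N] (A : Set N)
    {ι : Type x} {m : ι → ℕ} (I : (t : ι) → ℕ → Fin (m t) → N) : Prop :=
  ∀ t : ι, Indiscernible (L := L) (A ∪ {c | ∃ s : ι, s ≠ t ∧ ∃ i j, I s i j = c}) (I t)

/-- `dp-rk(T) < |ι|`: for every model `N` of `T`, every set `A` of parameters, every family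
`(I t : t ∈ ι)` of sequences of tuples of `N` that is mutually indiscernible over `A`, and every
element `b` of `N`, some `I t` is indiscernible over `A ∪ {b}`.

The usual convention that `N` is highly saturated and `A` is small makes no difference: whether
a sequence is indiscernible over a set does not change in an elementary extension, and every model
has elementary extensions that are as saturated as one likes. -/
def DpRankLT {L : FirstOrder.Language.{u, v}} (T : L.Theory) (ι : Type x) : Prop :=
  ∀ (N : Type w') [L.Structure N] [Nonempty N], N ⊨ T →
    ∀ (A : Set N) (m : ι → ℕ) (I : (t : ι) → ℕ → Fin (m t) → N) (b : N),
      MutuallyIndiscernible L A I → ∃ t : ι, Indiscernible (L := L) (A ∪ {b}) (I t)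

/-- The structure `M` is dp-minimal: its complete theory has dp-rank at most `1`, that is,
dp-rank less than `2`. -/
def IsDpMinimal (L : FirstOrder.Language.{u, v}) (M : Type w) [L.Structure M] : Prop :=
  DpRankLT.{u, v, max u v w, 0} (L.completeTheory M) (Fin 2)

/-- The `L`-structure on `K` is an expansion of the valued field `(K, val)`: the field operations
and the relation `val y ≤ val z` are definable in it. -/
structure IsExpansionOfValuedField (L : FirstOrder.Language.{u, v}) {K : Type w} [L.Structure K] [Field K]
    (val : AddValuation K (WithTop ℤ)) : Prop where
  add_definable : (Set.univ : Set K).Definable L {y : Fin 3 → K | y 0 + y 1 = y 2}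
  mul_definable : (Set.univ : Set K).Definable L {y : Fin 3 → K | y 0 * y 1 = y 2}
  val_definable : (Set.univ : Set K).Definable L {y : Fin 2 → K | val (y 0) ≤ val (y 1)}

/-- The ball `B(a, k) = {b : val (a - b) ≥ k}`. -/
def valBall {K : Type w} [Field K] (val : AddValuation K (WithTop ℤ)) (a : K) (k : ℤ) : Set K :=
  {b | (k : WithTop ℤ) ≤ val (a - b)}

/-- The set `P_n` of `n`-th powers of nonzero elements of `K`. -/
def nonzeroPowers (K : Type w) [Field K] (n : ℕ) : Set K :=
  {y | ∃ c : K, c ≠ 0 ∧ y = c ^ n}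

end DpMin

/-! Dp-minimality forbids one element from simultaneously cutting a pair in each of two sequences
(`IsDpMinimal.no_array`). One of the two sequences is always taken to consist of powers of an
element `π` of positive valuation, cut by valuation annuli. The rest of the argument concerns germs
at `0` of definable sets, under the action of `Kˣ` by dilation.

The stabilizer of the germ of `X - a` has finite index `n` in `Kˣ` (`germStabilizer_finiteIndex`),
so it contains all `n`-th powers. The group of `n`-th powers has finite index too
(`powers_finiteIndex`). For each coset representative `c`, the germ of `{y | a + c * y ^ n ∈ X}` is
invariant under all dilations, so it is trivial away from `0`
(`eventually_mem_or_notMem_of_germ_invariant`). Hence near `a`, apart from `a` itself, `X` is a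
union of some of the finitely many sets `a + c P_n`. -/

namespace DpMin

open Filter

/-! ### Random sequences from tensor powers of an ultrafilter -/

section Ultrafilter

/-- The `n`-fold tensor power of an ultrafilter on `ℕ`, as an ultrafilter on `n`-tuples. -/
noncomputable def tensorPow (U : Ultrafilter ℕ) : (n : ℕ) → Ultrafilter (Fin n → ℕ)
  | 0 => pure finZeroElim
  | n + 1 => U.bind fun a => (tensorPow U n).map (Fin.cons a)

theorem eventually_tensorPow_succ {U : Ultrafilter ℕ} {n : ℕ} {P : (Fin (n + 1) → ℕ) → Prop} :
    (∀ᶠ f in (tensorPow U (n + 1) : Filter _), P f) ↔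
      ∀ᶠ a in (U : Filter ℕ), ∀ᶠ f in (tensorPow U n : Filter _), P (Fin.cons a f) :=
  Iff.rfl

/-- This consistency of marginals is the source of indiscernibility: the law of a subtuple depends
only on its length. In the induction, the first coordinate is either the first one selected or is
integrated out. -/
theorem eventually_tensorPow_comp {U : Ultrafilter ℕ} {m : ℕ} :
    ∀ {n : ℕ} (i : Fin n → Fin m), StrictMono i → ∀ P : (Fin n → ℕ) → Prop,
      (∀ᶠ f in (tensorPow U m : Filter _), P (f ∘ i)) ↔
        ∀ᶠ f in (tensorPow U n : Filter _), P f := by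
  induction m with
  | zero =>
    intro n i hi P
    cases n with
    | zero =>
      have h : ∀ f : Fin 0 → ℕ, P f ↔ P finZeroElim := fun f => by
        rw [Subsingleton.elim f finZeroElim]
      simp only [h, eventually_const]
    | succ n => exact (i 0).elim0
  | succ m ih =>
    intro n i hi P
    cases n with
    | zero =>
      have h : ∀ f : Fin 0 → ℕ, P f ↔ P finZeroElim := fun f => by
        rw [Subsingleton.elim f finZeroElim]
      simp only [h, eventually_const]
    | succ n =>
      rw [eventually_tensorPow_succ]
      by_cases h0 : i 0 = 0
      · have hne : ∀ k : Fin n, i k.succ ≠ 0 := fun k h =>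
          absurd (hi (Fin.succ_pos k)) (by simp [h0, h])
        have hcons : ∀ (a : ℕ) (f : Fin m → ℕ), (Fin.cons a f : Fin (m + 1) → ℕ) ∘ i =
            Fin.cons a (f ∘ fun k => (i k.succ).pred (hne k)) := by
          intro a f
          funext k
          refine Fin.cases ?_ (fun k => ?_) k
          · simp [h0]
          · simp only [Function.comp_apply, Fin.cons_succ]
            conv_lhs => rw [← Fin.succ_pred (i k.succ) (hne k), Fin.cons_succ]
        rw [eventually_tensorPow_succ]
        refine eventually_congr (Eventually.of_forall fun a => ?_)
        simp only [hcons]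
        exact ih (fun k => (i k.succ).pred (hne k))
          (fun k l hkl => Fin.pred_lt_pred_iff.2 (hi (Fin.succ_lt_succ_iff.2 hkl)))
          (fun f => P (Fin.cons a f))
      · have hne : ∀ k, i k ≠ 0 := fun k h =>
          h0 (le_antisymm (h ▸ hi.monotone (Fin.zero_le k)) (Fin.zero_le _))
        have hcons : ∀ (a : ℕ) (f : Fin m → ℕ), (Fin.cons a f : Fin (m + 1) → ℕ) ∘ i =
            f ∘ fun k => (i k).pred (hne k) := by
          intro a f
          funext k
          simp only [Function.comp_apply]
          conv_lhs => rw [← Fin.succ_pred (i k) (hne k), Fin.cons_succ]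
        simp only [hcons]
        rw [eventually_const]
        exact ih _ (fun k l hkl => Fin.pred_lt_pred_iff.2 (hi hkl)) P

/-- An ultrafilter on sequences whose finite-dimensional marginals along increasing tuples of
indices are the tensor powers of `U`. -/
theorem exists_ultrafilter_marginals (U : Ultrafilter ℕ) :
    ∃ W : Ultrafilter (ℕ → ℕ), ∀ (n : ℕ) (i : Fin n → ℕ), StrictMono i →
      ∀ P : (Fin n → ℕ) → Prop, (∀ᶠ α in (W : Filter _), P (α ∘ i)) ↔
        ∀ᶠ f in (tensorPow U n : Filter _), P f := by
  let r : (n : ℕ) → (ℕ → ℕ) → Fin n → ℕ := fun n α k => α k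
  let F : ℕ → Filter (ℕ → ℕ) := fun n => comap (r n) (tensorPow U n)
  have hanti : Antitone F := by
    intro n m hnm s hs
    obtain ⟨t, ht, hts⟩ := hs
    refine ⟨(fun f : Fin m → ℕ => f ∘ Fin.castLE hnm) ⁻¹' t, ?_, hts⟩
    exact (eventually_tensorPow_comp (Fin.castLE hnm) (Fin.strictMono_castLE hnm) (· ∈ t)).2 ht
  have hF : ∀ n, (F n).NeBot := by
    intro n
    refine NeBot.comap_of_surj inferInstance fun f => ⟨fun k => if h : k < n then f ⟨k, h⟩ else 0, ?_⟩
    funext k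
    simp [r]
  have : (⨅ n, F n).NeBot :=
    iInf_neBot_of_directed (directed_of_isDirected_le fun _ _ h => hanti h) hF
  have hW : ∀ n (P : (Fin n → ℕ) → Prop), (∀ᶠ f in (tensorPow U n : Filter _), P f) →
      ∀ᶠ α in (Ultrafilter.of (⨅ n, F n) : Filter _), P (r n α) := fun n P h =>
    (Ultrafilter.of_le _).trans (iInf_le F n) (preimage_mem_comap h)
  refine ⟨Ultrafilter.of (⨅ n, F n), fun n i hi => ?_⟩
  have key : ∀ P : (Fin n → ℕ) → Prop, (∀ᶠ f in (tensorPow U n : Filter _), P f) →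
      ∀ᶠ α in (Ultrafilter.of (⨅ n, F n) : Filter _), P (α ∘ i) := by
    intro P h
    obtain ⟨m, hm⟩ : ∃ m, ∀ k, i k < m :=
      ⟨Finset.univ.sup i + 1, fun k => Nat.lt_succ_of_le (Finset.le_sup (Finset.mem_univ k))⟩
    exact hW m _ ((eventually_tensorPow_comp (fun k => (⟨i k, hm k⟩ : Fin m))
      (fun k l hkl => hi hkl) P).2 h)
  refine fun P => ⟨fun h => ?_, key P⟩
  by_contra h'
  obtain ⟨α, hα, hα'⟩ := (h.and (key (fun f => ¬P f) (Ultrafilter.eventually_not.2 h'))).exists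
  exact hα' hα

end Ultrafilter

/-! ### Łoś's theorem with parameters in ultrapowers -/

section Product

variable {L : FirstOrder.Language.{u, v}} {K : Type w} [L.Structure K] [Nonempty K]

/-- The ultrapower of `K` along `W`. -/
abbrev Ultrapower {ι : Type*} (W : Ultrafilter ι) (K : Type*) : Type _ :=
  (W : Filter ι).Product fun _ => K

/-- The class of a function in the ultrapower. -/
def Ultrapower.mk {ι : Type*} (W : Ultrafilter ι) {K : Type*} (f : ι → K) : Ultrapower W K :=
  (f : (W : Filter ι).Product fun _ => K)

theorem Ultrapower.realize_formula {ι : Type*} {W : Ultrafilter ι} {γ : Type*} (φ : L.Formula γ)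
    (f : γ → ι → K) :
    φ.Realize (fun p => Ultrapower.mk W (f p)) ↔
      ∀ᶠ s in (W : Filter ι), φ.Realize fun p => f p s :=
  Language.Ultraproduct.realize_formula_cast (M := fun _ : ι => K) (u := W) φ f

theorem Ultrapower.realize_formula_params {ι : Type*} {W : Ultrafilter ι}
    {B : Set (Ultrapower W K)} {γ : Type*} (φ : L[[B]].Formula γ)
    (r : B → ι → K) (hr : ∀ c : B, Ultrapower.mk W (r c) = (c : Ultrapower W K))
    (f : γ → ι → K) :
    φ.Realize (fun p => Ultrapower.mk W (f p)) ↔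
      ∀ᶠ s in (W : Filter ι), Language.Formula.Realize
        (Language.BoundedFormula.constantsVarsEquiv φ : L.Formula (B ⊕ γ))
          (Sum.elim (fun c => r c s) (fun p => f p s)) := by
  have h := Ultrapower.realize_formula (W := W)
    (Language.BoundedFormula.constantsVarsEquiv φ : L.Formula (B ⊕ γ)) (Sum.elim r f)
  refine Language.BoundedFormula.realize_constantsVarsEquiv.symm.trans
    (Iff.trans ?_ (h.trans (eventually_congr (Eventually.of_forall fun s => ?_))))
  · rw [iff_iff_eq, Language.Formula.Realize]
    congr 1
    funext i
    cases i with
    | inl c => simp [hr c]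
    | inr p => rfl
  · rw [iff_iff_eq]
    congr 1
    funext i
    cases i <;> rfl

end Product

/-- The product of an ultrafilter on sequences with itself. -/
def ultrafilterSquare (W : Ultrafilter (ℕ → ℕ)) : Ultrafilter ((ℕ → ℕ) × (ℕ → ℕ)) :=
  W.bind fun α => W.map fun β => (α, β)

theorem strictMono_pair {a b : ℕ} (h : a < b) : StrictMono ![a, b] := by
  intro i j hij
  fin_cases i <;> fin_cases j <;> simp_all

/-! ### A combinatorial obstruction to dp-minimality -/

section DpMinimal

variable {L : FirstOrder.Language.{u, v}} {K : Type w} [L.Structure K] [Nonempty K]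

/-- A sequence of the ultrapower given by coordinates in a random sequence is indiscernible over
any parameters whose representatives do not involve the random sequence. -/
theorem indiscernible_ultrapower {ι : Type*} {W : Ultrafilter ι} {B : Set (Ultrapower W K)}
    (z : ℕ → ι → K)
    (h : ∀ (n : ℕ) (i j : Fin n → ℕ), StrictMono i → StrictMono j →
      ∀ ψ : L.Formula (B ⊕ (Fin n × Fin 1)), ∃ r : B → ι → K,
        (∀ c : B, Ultrapower.mk W (r c) = (c : Ultrapower W K)) ∧
        ((∀ᶠ s in (W : Filter ι), ψ.Realize (Sum.elim (fun c => r c s) fun p => z (i p.1) s)) ↔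
          ∀ᶠ s in (W : Filter ι), ψ.Realize (Sum.elim (fun c => r c s) fun p => z (j p.1) s))) :
    Indiscernible (L := L) B (m := 1) fun n _ => Ultrapower.mk W (z n) := by
  intro n φ i j hi hj
  obtain ⟨r, hr, hrij⟩ := h n i j hi hj (Language.BoundedFormula.constantsVarsEquiv φ)
  exact (Ultrapower.realize_formula_params φ r hr fun p => z (i p.1)).trans
    (hrij.trans (Ultrapower.realize_formula_params φ r hr fun p => z (j p.1)).symm)

/-- Indiscernibility over `b` spreads `R` from the pair of indices `0, 1` to the pairs `0, 2` and
`1, 2`. By Łoś all three then hold at a common coordinate, against `hR'`. -/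
theorem not_homogeneous_of_indiscernible {ι : Type*} {W : Ultrafilter ι}
    {R : K → K → K → Prop}
    (hR : (Set.univ : Set K).Definable L {y : Fin 3 → K | R (y 0) (y 1) (y 2)})
    (hR' : ∀ x₀ x₁ x₂ b, R x₀ x₁ b → R x₀ x₂ b → R x₁ x₂ b → False)
    (z : ℕ → ι → K) (b : ι → K)
    (hz : Indiscernible (L := L)
      (Set.range (fun k : K => Ultrapower.mk W fun _ => k) ∪ {Ultrapower.mk W b})
      (m := 1) fun n _ => Ultrapower.mk W (z n)) :
    ¬∀ᶠ s in (W : Filter ι), R (z 0 s) (z 1 s) (b s) := by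
  intro h01
  obtain ⟨φ, hφ⟩ := Set.definable_iff_exists_formula_sum.1 hR
  have hφ' : ∀ x y b : K, R x y b ↔ φ.Realize (Sum.elim (fun k => (k : K)) ![x, y, b]) := by
    intro x y b
    exact Set.ext_iff.1 hφ ![x, y, b]
  set B := Set.range (fun k : K => Ultrapower.mk W fun _ => k) ∪ {Ultrapower.mk W b} with hB
  let e : (Set.univ : Set K) ⊕ Fin 3 → B ⊕ (Fin 2 × Fin 1) :=
    Sum.elim (fun k => Sum.inl ⟨Ultrapower.mk W fun _ => (k : K), Or.inl ⟨k, rfl⟩⟩)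
      ![Sum.inr (0, 0), Sum.inr (1, 0), Sum.inl ⟨Ultrapower.mk W b, Or.inr rfl⟩]
  obtain ⟨θ, hθ⟩ := (Set.definable_iff_exists_formula_sum (L := L) (A := B)
    (s := {v | (φ.relabel e).Realize (Sum.elim (↑) v)})).2 ⟨_, rfl⟩
  have key : ∀ a c, θ.Realize (fun p : Fin 2 × Fin 1 => Ultrapower.mk W (z (![a, c] p.1))) ↔
      ∀ᶠ s in (W : Filter ι), R (z a s) (z c s) (b s) := by
    intro a c
    refine (Set.ext_iff.1 hθ _).symm.trans ?_
    simp only [hφ', Set.mem_ofPred_eq, Language.Formula.realize_relabel]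
    refine Iff.trans ?_ (Ultrapower.realize_formula (W := W) φ
      (Sum.elim (fun k _ => (k : K)) ![z a, z c, b]) |>.trans
      (eventually_congr (Eventually.of_forall fun s => ?_)))
    · rw [iff_iff_eq]
      congr 1
      funext i
      rcases i with k | i
      · rfl
      · fin_cases i <;> rfl
    · rw [iff_iff_eq]
      congr 1
      funext i
      rcases i with k | i
      · rfl
      · fin_cases i <;> rfl
  have h02 := (key 0 2).1 ((hz 2 θ ![0, 1] ![0, 2] (strictMono_pair (by norm_num))
    (strictMono_pair (by norm_num))).1 ((key 0 1).2 h01))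
  have h12 := (key 1 2).1 ((hz 2 θ ![0, 1] ![1, 2] (strictMono_pair (by norm_num))
    (strictMono_pair (by norm_num))).1 ((key 0 1).2 h01))
  obtain ⟨s, ⟨h1, h2⟩, h3⟩ := ((h01.and h02).and h12).exists
  exact hR' _ _ _ _ h1 h2 h3

/-- In a dp-minimal structure there is no pair of sequences such that each pair of a pair of terms
of the first and a pair of terms of the second is cut simultaneously by one element. -/
theorem IsDpMinimal.no_array (hdp : IsDpMinimal L K) {R S : K → K → K → Prop}
    (hR : (Set.univ : Set K).Definable L {y : Fin 3 → K | R (y 0) (y 1) (y 2)})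
    (hS : (Set.univ : Set K).Definable L {y : Fin 3 → K | S (y 0) (y 1) (y 2)})
    (hR' : ∀ x₀ x₁ x₂ b, R x₀ x₁ b → R x₀ x₂ b → R x₁ x₂ b → False)
    (hS' : ∀ x₀ x₁ x₂ b, S x₀ x₁ b → S x₀ x₂ b → S x₁ x₂ b → False)
    (x y : ℕ → K)
    (h : ∀ᶠ i in atTop, ∀ᶠ i' in atTop, ∀ᶠ j in atTop, ∀ᶠ j' in atTop,
      ∃ b, R (x i) (x i') b ∧ S (y j) (y j') b) : False := by
  obtain ⟨W, hW⟩ := exists_ultrafilter_marginals (hyperfilter ℕ)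
  have hpair : ∀ P : ℕ → ℕ → Prop, (∀ᶠ i in atTop, ∀ᶠ i' in atTop, P i i') →
      ∀ᶠ α in (W : Filter (ℕ → ℕ)), P (α 0) (α 1) := by
    intro P hP
    refine (hW 2 ![0, 1] (strictMono_pair (by norm_num)) (fun f => P (f 0) (f 1))).2 ?_
    rw [eventually_tensorPow_succ]
    refine (hP.filter_mono Nat.hyperfilter_le_atTop).mono fun i hi => ?_
    rw [eventually_tensorPow_succ]
    refine (hi.filter_mono Nat.hyperfilter_le_atTop).mono fun i' hi' => ?_
    exact Eventually.of_forall fun f => hi'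
  -- The lift places the ultrapower in the universe over which `IsDpMinimal` quantifies.
  let V : Ultrafilter (ULift.{max u v} ((ℕ → ℕ) × (ℕ → ℕ))) := (ultrafilterSquare W).map ULift.up
  have hV : ∀ P : ULift.{max u v} ((ℕ → ℕ) × (ℕ → ℕ)) → Prop,
      (∀ᶠ s in (V : Filter (ULift.{max u v} ((ℕ → ℕ) × (ℕ → ℕ)))), P s) ↔
        ∀ᶠ α in (W : Filter (ℕ → ℕ)), ∀ᶠ β in (W : Filter (ℕ → ℕ)), P ⟨α, β⟩ := fun P => Iff.rfl
  have hb : ∀ᶠ s in (V : Filter (ULift.{max u v} ((ℕ → ℕ) × (ℕ → ℕ)))), ∃ b, R (x (s.down.1 0)) (x (s.down.1 1)) b ∧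
      S (y (s.down.2 0)) (y (s.down.2 1)) b := by
    rw [hV]
    refine (hpair (fun i i' => ∀ᶠ j in atTop, ∀ᶠ j' in atTop,
      ∃ b, R (x i) (x i') b ∧ S (y j) (y j') b) h).mono fun α hα => ?_
    exact hpair (fun j j' => ∃ b, R (x (α 0)) (x (α 1)) b ∧ S (y j) (y j') b) hα
  obtain ⟨b, hb⟩ := hb.choice
  let X : ℕ → ULift.{max u v} ((ℕ → ℕ) × (ℕ → ℕ)) → K := fun n s => x (s.down.1 n)
  let Y : ℕ → ULift.{max u v} ((ℕ → ℕ) × (ℕ → ℕ)) → K := fun n s => y (s.down.2 n)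
  let N : Type (max u v w) := Ultrapower V K
  let A : Set N := Set.range fun k : K => Ultrapower.mk V fun _ => k
  let I : (t : Fin 2) → ℕ → Fin 1 → N :=
    ![fun n _ => Ultrapower.mk V (X n), fun n _ => Ultrapower.mk V (Y n)]
  have hN : N ⊨ L.completeTheory K := by
    refine ⟨fun φ hφ => ?_⟩
    exact (Language.Ultraproduct.sentence_realize (M := fun _ => K) (u := V) φ).2
      (Eventually.of_forall fun _ => hφ)
  have hI : MutuallyIndiscernible L A (m := fun _ => 1) I := by
    intro t
    fin_cases t
    · refine indiscernible_ultrapower X fun n i j hi hj ψ => ?_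
      have hrep : ∀ c : ↥(A ∪ {c | ∃ s : Fin 2, s ≠ 0 ∧ ∃ i j, I s i j = c}),
          ∃ g : (ℕ → ℕ) → K, Ultrapower.mk V (fun s => g s.down.2) = (c : N) := by
        rintro ⟨c, ⟨k, rfl⟩ | ⟨s, hs, i, j, rfl⟩⟩
        · exact ⟨fun _ => k, rfl⟩
        · obtain rfl : s = 1 := by omega
          exact ⟨fun β => y (β i), rfl⟩
      choose g hg using hrep
      -- The parameters depend on the second random sequence `β` only, so averaging over `β` leaves
      -- a condition on finitely many terms of the first.
      refine ⟨fun c s => g c s.down.2, hg, ?_⟩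
      rw [hV, hV]
      let Q : (Fin n → ℕ) → Prop := fun f => ∀ᶠ β in (W : Filter (ℕ → ℕ)),
        ψ.Realize (Sum.elim (fun c => g c β) fun p => x (f p.1))
      exact (hW n i hi Q).trans (hW n j hj Q).symm
    · refine indiscernible_ultrapower Y fun n i j hi hj ψ => ?_
      have hrep : ∀ c : ↥(A ∪ {c | ∃ s : Fin 2, s ≠ 1 ∧ ∃ i j, I s i j = c}),
          ∃ g : (ℕ → ℕ) → K, Ultrapower.mk V (fun s => g s.down.1) = (c : N) := by
        rintro ⟨c, ⟨k, rfl⟩ | ⟨s, hs, i, j, rfl⟩⟩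
        · exact ⟨fun _ => k, rfl⟩
        · obtain rfl : s = 0 := by omega
          exact ⟨fun α => x (α i), rfl⟩
      choose g hg using hrep
      refine ⟨fun c s => g c s.down.1, hg, ?_⟩
      rw [hV, hV]
      -- Here the parameters depend on `α` only, and are constants once `α` is fixed.
      refine eventually_congr (Eventually.of_forall fun α => ?_)
      let Q : (Fin n → ℕ) → Prop := fun f =>
        ψ.Realize (Sum.elim (fun c => g c α) fun p => y (f p.1))
      exact (hW n i hi Q).trans (hW n j hj Q).symm
  obtain ⟨t, ht⟩ := hdp N hN A (fun _ => 1) I (Ultrapower.mk V b) hI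
  fin_cases t
  · exact not_homogeneous_of_indiscernible hR hR' X b ht (hb.mono fun s hs => hs.1)
  · exact not_homogeneous_of_indiscernible hS hS' Y b ht (hb.mono fun s hs => hs.2)

end DpMinimal

/-! ### Definability of the field operations, annuli and powers -/

section Definability

theorem definable_mem {L : FirstOrder.Language.{u, v}} {K : Type w} [L.Structure K] {α : Type*}
    {X : Set K} (hX : (Set.univ : Set K).Definable₁ L X)
    {f : (α → K) → K}
    (hf : (Set.univ : Set K).DefinableFun L f) :
    (Set.univ : Set K).Definable L {v : α → K | f v ∈ X} :=
  Set.Definable.preimage_map (F := fun v (_ : Fin 1) => f v) (fun _ => hf) hX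

variable {L : FirstOrder.Language.{u, v}} {K : Type w} [L.Structure K] [Field K]
  {val : AddValuation K (WithTop ℤ)} {α : Type*}

theorem IsExpansionOfValuedField.definableFun_add (hexp : IsExpansionOfValuedField L val)
    {f g : (α → K) → K} (hf : (Set.univ : Set K).DefinableFun L f)
    (hg : (Set.univ : Set K).DefinableFun L g) :
    (Set.univ : Set K).DefinableFun L fun v => f v + g v := by
  have h : (Set.univ : Set K).DefinableFun L fun y : Fin 2 → K => y 0 + y 1 :=
    hexp.add_definable.preimage_comp ![some 0, some 1, none]
  refine Set.DefinableFun.comp (g := fun v => ![f v, g v]) (fun i => ?_) h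
  fin_cases i
  exacts [hf, hg]

theorem IsExpansionOfValuedField.definableFun_mul (hexp : IsExpansionOfValuedField L val)
    {f g : (α → K) → K} (hf : (Set.univ : Set K).DefinableFun L f)
    (hg : (Set.univ : Set K).DefinableFun L g) :
    (Set.univ : Set K).DefinableFun L fun v => f v * g v := by
  have h : (Set.univ : Set K).DefinableFun L fun y : Fin 2 → K => y 0 * y 1 :=
    hexp.mul_definable.preimage_comp ![some 0, some 1, none]
  refine Set.DefinableFun.comp (g := fun v => ![f v, g v]) (fun i => ?_) h
  fin_cases i
  exacts [hf, hg]

theorem IsExpansionOfValuedField.definableFun_pow (hexp : IsExpansionOfValuedField L val)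
    {f : (α → K) → K} (hf : (Set.univ : Set K).DefinableFun L f) (n : ℕ) :
    (Set.univ : Set K).DefinableFun L fun v => f v ^ n := by
  induction n with
  | zero => simpa using L.definableFun_const α (Set.mem_univ (1 : K))
  | succ n ih => simpa only [pow_succ] using hexp.definableFun_mul ih hf

theorem IsExpansionOfValuedField.definable_le (hexp : IsExpansionOfValuedField L val)
    {f g : (α → K) → K} (hf : (Set.univ : Set K).DefinableFun L f)
    (hg : (Set.univ : Set K).DefinableFun L g) :
    (Set.univ : Set K).Definable L {v : α → K | val (f v) ≤ val (g v)} := by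
  refine Set.Definable.preimage_map (F := fun v => ![f v, g v]) (fun i => ?_) hexp.val_definable
  fin_cases i
  exacts [hf, hg]

/-- The relation `val t ≤ val b < val t'` is definable. -/
theorem IsExpansionOfValuedField.definable_annulus (hexp : IsExpansionOfValuedField L val) :
    (Set.univ : Set K).Definable L
      {y : Fin 3 → K | val (y 0) ≤ val (y 2) ∧ ¬val (y 1) ≤ val (y 2)} :=
  (hexp.definable_le (.proj L) (.proj L)).inter (hexp.definable_le (.proj L) (.proj L)).compl

theorem IsExpansionOfValuedField.definable_nonzeroPowers (hexp : IsExpansionOfValuedField L val)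
    (n : ℕ) : (Set.univ : Set K).Definable₁ L (nonzeroPowers K n) := by
  have h1 : (Set.univ : Set K).Definable L {v : Fin 1 ⊕ Fin 1 → K | v (Sum.inr 0) = 0} :=
    Set.DefinableFun.ofPred_eq_const (.proj L) (Set.mem_univ _)
  have h2 : (Set.univ : Set K).Definable L
      {v : Fin 1 ⊕ Fin 1 → K | v (Sum.inl 0) = v (Sum.inr 0) ^ n} :=
    Set.DefinableFun.ofPred_eq (.proj L) (hexp.definableFun_pow (.proj L) n)
  refine (congrArg ((Set.univ : Set K).Definable L) (Set.ext fun v => ?_)).mp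
    (h1.compl.inter h2).exists_of_finite
  constructor
  · rintro ⟨u, hu⟩
    exact ⟨u 0, hu⟩
  · rintro ⟨c, hc⟩
    exact ⟨fun _ => c, hc⟩

end Definability

/-! ### Valuation estimates and the germ stabilizer -/

section Valuation

variable {K : Type w} [Field K] (val : AddValuation K (WithTop ℤ))

theorem exists_val_eq_coe {x : K} (hx : x ≠ 0) : ∃ n : ℤ, val x = n := by
  obtain ⟨n, hn⟩ := WithTop.ne_top_iff_exists.1 (fun h => hx ((AddValuation.top_iff val).1 h))
  exact ⟨n, hn.symm⟩

theorem exists_val_pos (hnontriv : ∃ c : K, c ≠ 0 ∧ val c ≠ 0) :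
    ∃ π : K, π ≠ 0 ∧ ∃ p : ℤ, 0 < p ∧ val π = p := by
  obtain ⟨c, hc, hc'⟩ := hnontriv
  obtain ⟨n, hn⟩ := exists_val_eq_coe val hc
  obtain ⟨m, hm⟩ := exists_val_eq_coe val (inv_ne_zero hc)
  have h : n + m = 0 := by
    have := val.map_mul c c⁻¹
    rw [mul_inv_cancel₀ hc, val.map_one, hn, hm] at this
    exact_mod_cast this.symm
  have hn0 : n ≠ 0 := by
    rintro rfl
    exact hc' (by simpa using hn)
  rcases lt_or_gt_of_ne hn0 with h0 | h0
  · exact ⟨c⁻¹, inv_ne_zero hc, m, by omega, hm⟩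
  · exact ⟨c, hc, n, h0, hn⟩

variable {val}

theorem val_pow_eq {π : K} {p : ℤ} (hp : val π = p) (n : ℕ) :
    val (π ^ n) = ((n * p : ℤ) : WithTop ℤ) := by
  induction n with
  | zero => simp
  | succ n ih =>
    rw [pow_succ, val.map_mul, ih, hp, ← WithTop.coe_add]
    congr 1
    push_cast
    ring

theorem exists_le_val_mul {b : K} (hb : b ≠ 0) (k : ℤ) :
    ∃ k' : ℤ, ∀ y, (k' : WithTop ℤ) ≤ val y → (k : WithTop ℤ) ≤ val (b * y) := by
  obtain ⟨n, hn⟩ := exists_val_eq_coe val hb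
  refine ⟨k - n, fun y hy => ?_⟩
  by_cases hy0 : y = 0
  · simp [hy0]
  obtain ⟨m, hm⟩ := exists_val_eq_coe val hy0
  rw [hm] at hy
  rw [val.map_mul, hn, hm]
  norm_cast at hy ⊢
  omega

theorem exists_le_val_mul_pow {c : K} (hc : c ≠ 0) {n : ℕ} (hn : n ≠ 0) (k : ℤ) :
    ∃ k' : ℤ, ∀ y, (k' : WithTop ℤ) ≤ val y → (k : WithTop ℤ) ≤ val (c * y ^ n) := by
  obtain ⟨k₁, hk₁⟩ := exists_le_val_mul (val := val) hc k
  -- The bound `0` ensures that raising `y` to the power `n` does not lower its valuation.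
  refine ⟨max k₁ 0, fun y hy => hk₁ _ ?_⟩
  by_cases hy0 : y = 0
  · simp [hy0, hn]
  obtain ⟨m, hm⟩ := exists_val_eq_coe val hy0
  rw [hm] at hy
  rw [val_pow_eq hm]
  norm_cast at hy ⊢
  have hm0 : 0 ≤ m := (le_max_right _ _).trans hy
  have hn1 : (1 : ℤ) ≤ n := by exact_mod_cast Nat.one_le_iff_ne_zero.2 hn
  nlinarith [le_max_left k₁ 0]

theorem exists_le_of_le_val_mul_pow {c : K} (hc : c ≠ 0) (n : ℕ) (k : ℤ) :
    ∃ k' : ℤ, ∀ y, y ≠ 0 → (k' : WithTop ℤ) ≤ val (c * y ^ n) → (k : WithTop ℤ) ≤ val y := by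
  obtain ⟨e, he⟩ := exists_val_eq_coe val hc
  refine ⟨e + n * max k 0 + 1, fun y hy0 hy => ?_⟩
  obtain ⟨m, hm⟩ := exists_val_eq_coe val hy0
  rw [val.map_mul, he, val_pow_eq hm] at hy
  rw [hm]
  norm_cast at hy ⊢
  by_contra hlt
  have hmk : m ≤ max k 0 := by omega
  have : (n : ℤ) * m ≤ n * max k 0 := mul_le_mul_of_nonneg_left hmk (by positivity)
  omega

theorem eventually_not_val_pow_le {π : K} {p : ℤ} (hp0 : 0 < p) (hp : val π = p) {b : K}
    (hb : b ≠ 0) : ∀ᶠ j : ℕ in atTop, ¬val (π ^ j) ≤ val b := by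
  obtain ⟨e, he⟩ := exists_val_eq_coe val hb
  filter_upwards [eventually_gt_atTop e.toNat] with j hj
  rw [val_pow_eq hp, he]
  norm_cast
  have : (j : ℤ) ≤ j * p := le_mul_of_one_le_right (by positivity) hp0
  omega

variable (val)

/-- The group of units `b` such that `X` and `b⁻¹ X` have the same germ at `0`. -/
def germStabilizer (X : Set K) : Subgroup Kˣ where
  carrier := {b | ∃ k : ℤ, ∀ y, (k : WithTop ℤ) ≤ val y → (y ∈ X ↔ (b : K) * y ∈ X)}
  one_mem' := ⟨0, fun y _ => by simp⟩
  mul_mem' := by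
    rintro b c ⟨k, hk⟩ ⟨l, hl⟩
    obtain ⟨k', hk'⟩ := exists_le_val_mul (val := val) c.ne_zero k
    refine ⟨max k' l, fun y hy => ?_⟩
    rw [hl y (le_trans (by exact_mod_cast le_max_right _ _) hy),
      hk _ (hk' y (le_trans (by exact_mod_cast le_max_left _ _) hy)), Units.val_mul, mul_assoc]
  inv_mem' := by
    rintro b ⟨k, hk⟩
    obtain ⟨k', hk'⟩ := exists_le_val_mul (val := val) (b⁻¹).ne_zero k
    exact ⟨k', fun y hy => by rw [hk _ (hk' y hy), Units.mul_inv_cancel_left]⟩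

end Valuation

/-! ### Consequences of dp-minimality for germs at zero -/

section Germs

variable {L : FirstOrder.Language.{u, v}} {K : Type w} [L.Structure K] [Field K]
  {val : AddValuation K (WithTop ℤ)}

/-- For representatives `c i`, `c i'` of different cosets there are `b` arbitrarily close to `0` at
which `c i * b ∈ X` and `c i' * b ∈ X` disagree. Infinitely many cosets would therefore give a
forbidden array, with such `b` also lying in prescribed annuli. Three truth values cannot be
pairwise different. -/
theorem germStabilizer_finiteIndex (hnontriv : ∃ c : K, c ≠ 0 ∧ val c ≠ 0)
    (hexp : IsExpansionOfValuedField L val) (hdp : IsDpMinimal L K) {X : Set K}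
    (hX : (Set.univ : Set K).Definable₁ L X) : (germStabilizer val X).FiniteIndex := by
  by_contra hinf
  have : Infinite (Kˣ ⧸ germStabilizer val X) := by
    rw [← not_finite_iff_infinite]
    exact fun h => hinf Subgroup.finiteIndex_of_finite_quotient
  obtain ⟨π, hπ, p, hp0, hp⟩ := exists_val_pos val hnontriv
  let q := Infinite.natEmbedding (Kˣ ⧸ germStabilizer val X)
  let c : ℕ → Kˣ := fun i => (q i).out
  have hc : ∀ i i', i ≠ i' → (c i')⁻¹ * c i ∉ germStabilizer val X := by
    intro i i' hii' h
    refine hii' (q.injective ?_)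
    rw [← QuotientGroup.out_eq' (q i), ← QuotientGroup.out_eq' (q i')]
    exact (QuotientGroup.eq.2 h).symm
  have hmem : ∀ i : Fin 3, (Set.univ : Set K).Definable L {y : Fin 3 → K | y i * y 2 ∈ X} :=
    fun i => definable_mem hX (hexp.definableFun_mul (.proj L) (.proj L))
  have hR : (Set.univ : Set K).Definable L
      {y : Fin 3 → K | ¬(y 0 * y 2 ∈ X ↔ y 1 * y 2 ∈ X)} := by
    refine (congrArg _ (Set.ext fun v => ?_)).mp
      (((hmem 0).inter (hmem 1).compl).union ((hmem 1).inter (hmem 0).compl))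
    simp only [Set.mem_union, Set.mem_inter_iff, Set.mem_compl_iff, Set.mem_ofPred_eq]
    tauto
  refine hdp.no_array (R := fun x y b => ¬(x * b ∈ X ↔ y * b ∈ X))
    (S := fun t t' b => val t ≤ val b ∧ ¬val t' ≤ val b) hR hexp.definable_annulus
    (fun _ _ _ _ => by tauto) (fun _ _ _ _ h _ h' => h.2 h'.1) (fun i => (c i : K))
    (fun j => π ^ j) (Eventually.of_forall fun i => ?_)
  filter_upwards [eventually_gt_atTop i] with i' hi'
  refine Eventually.of_forall fun j => ?_
  obtain ⟨k, hk⟩ := exists_le_val_mul (val := val) ((c i')⁻¹).ne_zero (j * p)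
  have hne := hc i i' hi'.ne
  change ¬∃ k : ℤ, _ at hne
  push Not at hne
  obtain ⟨y, hy, hyX⟩ := hne k
  have hy0 : y ≠ 0 := by
    rintro rfl
    simp at hyX
  filter_upwards [eventually_not_val_pow_le hp0 hp (mul_ne_zero ((c i')⁻¹).ne_zero hy0)] with j' hj'
  refine ⟨((c i')⁻¹ : Kˣ) * y, ?_, ?_, hj'⟩
  · rw [Units.mul_inv_cancel_left, ← mul_assoc, ← Units.val_mul, mul_comm (c i)]
    tauto
  · rw [val_pow_eq hp]
    exact_mod_cast hk y hy

/-- A unit `b` stabilizing the germ of `P_n` is itself an `n`-th power: it sends a sufficiently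
small `n`-th power of a power of `π` to an `n`-th power. -/
theorem powers_finiteIndex (hnontriv : ∃ c : K, c ≠ 0 ∧ val c ≠ 0)
    (hexp : IsExpansionOfValuedField L val) (hdp : IsDpMinimal L K) {n : ℕ} (hn : n ≠ 0) :
    (powMonoidHom n : Kˣ →* Kˣ).range.FiniteIndex := by
  have := germStabilizer_finiteIndex hnontriv hexp hdp (hexp.definable_nonzeroPowers n)
  refine Subgroup.finiteIndex_of_le (H := germStabilizer val (nonzeroPowers K n)) ?_
  rintro b ⟨k, hk⟩
  obtain ⟨π, hπ, p, hp0, hp⟩ := exists_val_pos val hnontriv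
  have hk' : (k : WithTop ℤ) ≤ val ((π ^ k.toNat) ^ n) := by
    rw [← pow_mul, val_pow_eq hp]
    norm_cast
    have h1 : k.toNat * 1 ≤ k.toNat * n := Nat.mul_le_mul_left _ (Nat.one_le_iff_ne_zero.2 hn)
    have h2 : ((k.toNat * n : ℕ) : ℤ) ≤ (k.toNat * n : ℕ) * p :=
      le_mul_of_one_le_right (by positivity) hp0
    omega
  obtain ⟨c, hc, hbc⟩ := (hk _ hk').1 ⟨_, pow_ne_zero _ hπ, rfl⟩
  refine ⟨Units.mk0 c hc / Units.mk0 (π ^ k.toNat) (pow_ne_zero _ hπ), Units.ext ?_⟩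
  simp only [powMonoidHom_apply, Units.val_pow_eq_pow_val, Units.val_div_eq_div_val, Units.val_mk0,
    div_pow, ← hbc]
  exact mul_div_cancel_right₀ _ (pow_ne_zero _ (pow_ne_zero _ hπ))

/-- A definable set whose germ at `0` is invariant under all dilations is, near `0`, empty or
everything, up to the point `0`. -/
theorem eventually_mem_or_notMem_of_germ_invariant (hnontriv : ∃ c : K, c ≠ 0 ∧ val c ≠ 0)
    (hexp : IsExpansionOfValuedField L val) (hdp : IsDpMinimal L K) {X : Set K}
    (hX : (Set.univ : Set K).Definable₁ L X)
    (h : ∀ b : K, b ≠ 0 → ∃ k : ℤ, ∀ y, (k : WithTop ℤ) ≤ val y → (y ∈ X ↔ b * y ∈ X)) :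
    ∃ k : ℤ, (∀ y, y ≠ 0 → (k : WithTop ℤ) ≤ val y → y ∈ X) ∨
      ∀ y, y ≠ 0 → (k : WithTop ℤ) ≤ val y → y ∉ X := by
  by_contra hcon
  push Not at hcon
  choose hout hin using hcon
  obtain ⟨π, hπ, p, hp0, hp⟩ := exists_val_pos val hnontriv
  obtain ⟨kπ, hkπ⟩ := h π hπ
  obtain ⟨y₀, hy₀, hky₀, hy₀X⟩ := hout kπ
  obtain ⟨e, he⟩ := exists_val_eq_coe val hy₀
  rw [he] at hky₀
  have hkπe : kπ ≤ e := by exact_mod_cast hky₀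
  have hval : ∀ m : ℕ, val (π ^ m * y₀) = ((m * p + e : ℤ) : WithTop ℤ) := fun m => by
    rw [val.map_mul, val_pow_eq hp, he, WithTop.coe_add]
  -- The points `π ^ m * y₀` stay in the ball where dilation by `π` preserves `X`, so they all
  -- remain outside `X`.
  have hpow : ∀ m : ℕ, π ^ m * y₀ ∉ X := by
    intro m
    induction m with
    | zero => simpa using hy₀X
    | succ m ih =>
      rw [pow_succ', mul_assoc, ← hkπ]
      · exact ih
      · rw [hval]
        norm_cast
        nlinarith [Int.natCast_nonneg m, mul_nonneg (Int.natCast_nonneg m) hp0.le]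
  choose x hx hkx hxX using fun n : ℕ => hin n
  have hmem : ∀ i : Fin 3, (Set.univ : Set K).Definable L {y : Fin 3 → K | y 2 * y i ∈ X} :=
    fun i => definable_mem hX (hexp.definableFun_mul (.proj L) (.proj L))
  refine hdp.no_array (R := fun t t' b => val t ≤ val b ∧ ¬val t' ≤ val b)
    (S := fun x y b => ¬b * x ∈ X ∧ b * y ∈ X) hexp.definable_annulus
    ((hmem 0).compl.inter (hmem 1)) (fun _ _ _ _ h _ h' => h.2 h'.1)
    (fun _ _ _ _ h _ h' => h'.1 h.2) (fun j => π ^ j) x (Eventually.of_forall fun j => ?_)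
  filter_upwards [eventually_gt_atTop j] with j' hj'
  filter_upwards [eventually_ge_atTop e.toNat] with i hi
  obtain ⟨f, hf⟩ := exists_val_eq_coe val (hx i)
  have hef : e ≤ f := by
    have h1 := hkx i
    rw [hf] at h1
    have h2 : ((i : ℕ) : ℤ) ≤ f := by exact_mod_cast h1
    omega
  -- The cutting element will be `u = π ^ m * y₀ / x i`. These inequalities put its valuation in `[j
  -- * p, (j + 1) * p)`. Then `u * x i` is outside `X`, while `u * x i'` lies in `X` for large `i'`
  -- by germ invariance under `u`.
  obtain ⟨m, hm1, hm2⟩ : ∃ m : ℕ, f + j * p ≤ m * p + e ∧ m * p + e < f + j * p + p := by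
    -- This is `j` plus the ceiling of `(f - e) / p`; as `e ≤ f`, the truncation loses nothing.
    refine ⟨((f - e + (p - 1)) / p).toNat + j, ?_⟩
    have h0 : 0 ≤ (f - e + (p - 1)) / p := Int.ediv_nonneg (by omega) hp0.le
    have h1 := Int.emod_add_mul_ediv (f - e + (p - 1)) p
    have h2 := Int.emod_nonneg (f - e + (p - 1)) hp0.ne'
    have h3 := Int.emod_lt_of_pos (f - e + (p - 1)) hp0
    push_cast
    rw [Int.toNat_of_nonneg h0]
    constructor <;> nlinarith
  have hu : π ^ m * y₀ / x i ≠ 0 :=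
    div_ne_zero (mul_ne_zero (pow_ne_zero _ hπ) hy₀) (hx i)
  obtain ⟨g, hg⟩ := exists_val_eq_coe val hu
  have hgf : g + f = m * p + e := by
    have h1 := val.map_mul (π ^ m * y₀ / x i) (x i)
    rw [div_mul_cancel₀ _ (hx i), hval, hg, hf] at h1
    exact_mod_cast h1.symm
  obtain ⟨k, hk⟩ := h _ hu
  filter_upwards [eventually_ge_atTop k.toNat] with i' hi'
  refine ⟨π ^ m * y₀ / x i, ⟨?_, ?_⟩, ?_, ?_⟩
  · rw [val_pow_eq hp, hg]
    norm_cast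
    omega
  · rw [val_pow_eq hp, hg]
    norm_cast
    have : ((j : ℤ) + 1) * p ≤ j' * p :=
      mul_le_mul_of_nonneg_right (by exact_mod_cast hj') hp0.le
    nlinarith
  · rw [div_mul_cancel₀ _ (hx i)]
    exact hpow m
  · refine (hk _ (le_trans ?_ (hkx i'))).1 (hxX i')
    norm_cast
    omega

end Germs

end DpMin

/-! ### Assembling the local description of `X` at `a` -/

theorem mainTheorem5 (L : FirstOrder.Language.{u, v}) (K : Type w) [L.Structure K] [Field K]
    (val : AddValuation K (WithTop ℤ)) (hnontriv : ∃ c : K, c ≠ 0 ∧ val c ≠ 0)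
    (hexp : DpMin.IsExpansionOfValuedField L val) (hdp : DpMin.IsDpMinimal L K)
    (X : Set K) (hX : (Set.univ : Set K).Definable₁ L X) (a : K) :
    ∃ (k : ℤ) (S : Set (K × ℕ)), S.Finite ∧ (∀ p ∈ S, 1 ≤ p.2) ∧
      DpMin.valBall val a k ∩ X =
        DpMin.valBall val a k ∩
          ⋃ p ∈ S, (fun y => a + p.1 * y) '' DpMin.nonzeroPowers K p.2 := by
  have hX₀ : (Set.univ : Set K).Definable₁ L {y | a + y ∈ X} :=
    DpMin.definable_mem hX (hexp.definableFun_add (L.definableFun_const _ (Set.mem_univ a))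
      (.proj L))
  have hfin := DpMin.germStabilizer_finiteIndex hnontriv hexp hdp hX₀
  obtain ⟨n, hn, hpow⟩ : ∃ n : ℕ, n ≠ 0 ∧
      ∀ b : Kˣ, b ^ n ∈ DpMin.germStabilizer val {y | a + y ∈ X} :=
    ⟨_, hfin.index_ne_zero, fun b => Subgroup.pow_index_mem _ b⟩
  have hPfin := DpMin.powers_finiteIndex hnontriv hexp hdp hn
  let c : Kˣ ⧸ (powMonoidHom n : Kˣ →* Kˣ).range → Kˣ := Quotient.out
  have hdich : ∀ q, ∃ k : ℤ,
      (∀ y, y ≠ 0 → (k : WithTop ℤ) ≤ val y → y ∈ {y | a + c q * y ^ n ∈ X}) ∨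
        ∀ y, y ≠ 0 → (k : WithTop ℤ) ≤ val y → y ∉ {y | a + c q * y ^ n ∈ X} := by
    intro q
    refine DpMin.eventually_mem_or_notMem_of_germ_invariant hnontriv hexp hdp
      (DpMin.definable_mem hX₀ (hexp.definableFun_mul
        (L.definableFun_const _ (Set.mem_univ (c q : K))) (hexp.definableFun_pow (.proj L) n)))
      fun b hb => ?_
    obtain ⟨k, hk⟩ := hpow (Units.mk0 b hb)
    obtain ⟨k', hk'⟩ := DpMin.exists_le_val_mul_pow (val := val) (c q).ne_zero hn k
    refine ⟨k', fun y hy => (hk _ (hk' y hy)).trans ?_⟩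
    -- Dilating `y` by `b` dilates `c q * y ^ n` by `b ^ n`, which stabilizes the germ.
    have : b ^ n * ((c q : K) * y ^ n) = c q * (b * y) ^ n := by ring
    simp [this]
  choose k hk using hdich
  choose l hl using fun q => DpMin.exists_le_of_le_val_mul_pow (val := val) (c q).ne_zero n (k q)
  -- There are finitely many cosets, so one radius serves them all.
  obtain ⟨M, hM⟩ := Finite.exists_le l
  let G := {q | ∀ y, y ≠ 0 → (k q : WithTop ℤ) ≤ val y → y ∈ {y | a + c q * y ^ n ∈ X}}
  -- The pair `(0, 1)` contributes the singleton `{a}`, which no `a + c P_n` with `c ≠ 0` meets.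
  refine ⟨M, (fun q => ((c q : K), n)) '' G ∪ {p | p = (0, 1) ∧ a ∈ X}, ?_, ?_, ?_⟩
  · exact (Set.toFinite _).union ((Set.finite_singleton (0, 1)).subset fun p hp => hp.1)
  · rintro _ (⟨q, -, rfl⟩ | ⟨rfl, -⟩)
    · exact Nat.one_le_iff_ne_zero.2 hn
    · exact le_rfl
  · ext z
    simp only [Set.mem_inter_iff, and_congr_right_iff]
    intro hz
    have hzM : (M : WithTop ℤ) ≤ val (z - a) := by
      rw [val.map_sub_swap]
      exact hz
    simp only [Set.mem_iUnion, exists_prop]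
    constructor
    · intro hzX
      by_cases hza : z = a
      · subst hza
        exact ⟨(0, 1), Or.inr ⟨rfl, hzX⟩, 1, ⟨1, one_ne_zero, by simp⟩, by simp⟩
      · let d := Units.mk0 (z - a) (sub_ne_zero.2 hza)
        obtain ⟨x, hx⟩ := QuotientGroup.eq.1
          (QuotientGroup.out_eq' (d : Kˣ ⧸ (powMonoidHom n : Kˣ →* Kˣ).range))
        have hdx : z - a = c d * (x : K) ^ n := by
          have : d = c d * x ^ n := by
            rw [← powMonoidHom_apply, hx]
            exact (mul_inv_cancel_left _ _).symm
          exact congrArg Units.val this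
        have hzx : a + c d * (x : K) ^ n = z := by rw [← hdx]; ring
        have hkx : (k d : WithTop ℤ) ≤ val (x : K) :=
          hl d x x.ne_zero (le_trans (by exact_mod_cast hM d) (hdx ▸ hzM))
        refine ⟨(c d, n), Or.inl ⟨d, ?_, rfl⟩, (x : K) ^ n, ⟨x, x.ne_zero, rfl⟩, hzx⟩
        refine (hk d).resolve_right fun h => h x x.ne_zero hkx ?_
        rw [Set.mem_ofPred_eq, hzx]
        exact hzX
    · rintro ⟨_, ⟨q, hq, rfl⟩ | ⟨rfl, ha⟩, _, ⟨x, hx, rfl⟩, rfl⟩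
      · refine hq x hx (hl q x hx (le_trans (WithTop.coe_le_coe.2 (hM q)) ?_))
        simpa using hzM
      · simpa using ha
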